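/- Let $K$ be an algebraically closed field with a real valuation $|\cdot|$, i.e. a map $|\cdot|:K\to\mathbb R_{\ge 0}$ with $|a|=0\Leftrightarrow a=0$, $|ab|=|a||b|$, $|a+b|\le|a|+|b|$ (of arbitrary characteristic; the trivial valuation is allowed). Let $K\{x\}=K\{x_1,\dots,x_n\}$ be the ring of convergent power series, i.e. of those $\sum_\alpha c_\alpha x^\alpha\in K[[x]]$ with $\sum_\alpha |c_\alpha|\varepsilon^\alpha<\infty$ for some $\varepsilon\in(\mathbb R_{>0})^n$, and let $\mathfrak m=\langle x_1,\dots,x_n\rangle$. For $f\in K\{x\}$ put $j(f)=\langle \partial f/\partial x_1,\dots,\partial f/\partial x_n\rangle$, $\mu(f)=\dim_K K\{x\}/j(f)$ and $\tau(f)=\dim_K K\{x\}/(\langle f\rangle+j(f))$. For $f,g\in K\{x\}$, $f$ is right equivalent to $g$ if $f=\varphi(g)$ for some $K$-algebra automorphism $\varphi$ of $K\{x\}$, and contact equivalent to $g$ if $f=u\cdot\varphi(g)$ for some such $\varphi$ and some unit $u\in K\{x\}^*$. An unfolding of $f\in\mathfrak m$ over $K^k$ is a family $F(x,t)=\sum_\alpha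 a_\alpha(t)x^\alpha$ with $a_\alpha\in K[t_1,\dots,t_k]$ such that $F_t:=F(x,t)\in K\{x\}$ and $F_t\in\mathfrak m$ for every $t\in K^k$, and $F_0=f$. The series $f\in\mathfrak m$ is of finite deformation type for right (resp. contact) equivalence if there is a finite set $S\subseteq K\{x\}$ such that for every $k$ and every unfolding $F$ of $f$ over $K^k$ there is a Zariski-open neighbourhood $U$ of $0$ in $K^k$ such that for each $t\in U$ the series $F_t$ is right (resp. contact) equivalent to some element of $S$. Call $V\subseteq\mathfrak m$ open if for every $k\ge 0$ the set of $k$-jets of elements of $V$ is Zariski-open in the affine space $\mathfrak m/\mathfrak m^{k+1}$. The series $f\in\mathfrak m$ is right (resp. contact) simple if there is an open $V\subseteq\mathfrak m$ containing $f$ that meets only finitely many right (resp. contact) equivalence classes. **Lemma.** Let $f\in\mathfrak m$. If $f$ is of finite deformation type for right (resp. contact) equivalence, then $\mu(f)<\infty$ (resp. $\tau(f)<\infty$). The same holds if $f$ is right (resp. contact) simple. -/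

import Mathlib

noncomputable section

namespace Singularity

/-! ### Convergent power series over a real valued field -/

/-- A formal power series `f = ∑ c_α x^α` over a field with real valuation `‖·‖` is convergent if
`∑ |c_α| ε^α < ∞` for some vector `ε` of positive real numbers. -/
def IsConvergent {K : Type*} [NormedField K] {n : ℕ} (f : MvPowerSeries (Fin n) K) : Prop :=
  ∃ ε : Fin n → ℝ, (∀ i, 0 < ε i) ∧
    Summable fun α : Fin n →₀ ℕ => ‖MvPowerSeries.coeff α f‖ * ∏ i, ε i ^ α i

theorem IsConvergent.add {K : Type*} [NormedField K] {n : ℕ} {f g : MvPowerSeries (Fin n) K}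
    (hf : IsConvergent f) (hg : IsConvergent g) : IsConvergent (f + g) := by
  obtain ⟨ε, hε, hf⟩ := hf
  obtain ⟨δ, hδ, hg⟩ := hg
  refine ⟨fun i => min (ε i) (δ i), fun i => lt_min (hε i) (hδ i), ?_⟩
  have hpos : ∀ i, 0 ≤ min (ε i) (δ i) := fun i => (lt_min (hε i) (hδ i)).le
  refine Summable.of_nonneg_of_le (fun α => ?_) (fun α => ?_) (hf.add hg)
  · exact mul_nonneg (norm_nonneg _) (Finset.prod_nonneg fun i _ => pow_nonneg (hpos i) _)
  · have h1 : ∏ i, min (ε i) (δ i) ^ α i ≤ ∏ i, ε i ^ α i :=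
      Finset.prod_le_prod (fun i _ => pow_nonneg (hpos i) _)
        fun i _ => pow_le_pow_left₀ (hpos i) (min_le_left _ _) _
    have h2 : ∏ i, min (ε i) (δ i) ^ α i ≤ ∏ i, δ i ^ α i :=
      Finset.prod_le_prod (fun i _ => pow_nonneg (hpos i) _)
        fun i _ => pow_le_pow_left₀ (hpos i) (min_le_right _ _) _
    have h0 : 0 ≤ ∏ i, min (ε i) (δ i) ^ α i :=
      Finset.prod_nonneg fun i _ => pow_nonneg (hpos i) _
    rw [map_add]
    calc _ ≤ (‖MvPowerSeries.coeff α f‖ + ‖MvPowerSeries.coeff α g‖) *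
          ∏ i, min (ε i) (δ i) ^ α i := mul_le_mul_of_nonneg_right (norm_add_le _ _) h0
      _ ≤ _ := by
        rw [add_mul]
        exact add_le_add (mul_le_mul_of_nonneg_left h1 (norm_nonneg _))
          (mul_le_mul_of_nonneg_left h2 (norm_nonneg _))

theorem summable_weighted_coeff_mul {K : Type*} [NormedField K] {n : ℕ}
    (f g : MvPowerSeries (Fin n) K) (w : (Fin n →₀ ℕ) → ℝ) (h0 : ∀ α, 0 ≤ w α)
    (hw : ∀ α β, w (α + β) = w α * w β)
    (hf : Summable fun α => ‖MvPowerSeries.coeff α f‖ * w α)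
    (hg : Summable fun α => ‖MvPowerSeries.coeff α g‖ * w α) :
    Summable fun α => ‖MvPowerSeries.coeff α (f * g)‖ * w α := by
  classical
  have hp : Summable fun x : (Fin n →₀ ℕ) × (Fin n →₀ ℕ) =>
      (‖MvPowerSeries.coeff x.1 f‖ * w x.1) * (‖MvPowerSeries.coeff x.2 g‖ * w x.2) :=
    hf.mul_of_nonneg hg (fun α => mul_nonneg (norm_nonneg _) (h0 α))
      (fun α => mul_nonneg (norm_nonneg _) (h0 α))
  have hs := summable_sum_mul_antidiagonal_of_summable_mul
    (f := fun α => ‖MvPowerSeries.coeff α f‖ * w α)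
    (g := fun α => ‖MvPowerSeries.coeff α g‖ * w α) hp
  refine Summable.of_nonneg_of_le (fun α => mul_nonneg (norm_nonneg _) (h0 α)) (fun α => ?_) hs
  rw [MvPowerSeries.coeff_mul]
  refine (mul_le_mul_of_nonneg_right (norm_sum_le _ _) (h0 α)).trans ?_
  rw [Finset.sum_mul]
  refine Finset.sum_le_sum fun p hp => ?_
  have hα : p.1 + p.2 = α := Finset.HasAntidiagonal.mem_antidiagonal.mp hp
  rw [← hα, hw, norm_mul]
  exact le_of_eq (by ring)

theorem IsConvergent.mul {K : Type*} [NormedField K] {n : ℕ} {f g : MvPowerSeries (Fin n) K}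
    (hf : IsConvergent f) (hg : IsConvergent g) : IsConvergent (f * g) := by
  obtain ⟨ε, hε, hf⟩ := hf
  obtain ⟨δ, hδ, hg⟩ := hg
  have hρ : ∀ i, 0 < min (ε i) (δ i) := fun i => lt_min (hε i) (hδ i)
  have h0 : ∀ α : Fin n →₀ ℕ, 0 ≤ ∏ i, min (ε i) (δ i) ^ α i := fun α =>
    Finset.prod_nonneg fun i _ => pow_nonneg (hρ i).le _
  refine ⟨fun i => min (ε i) (δ i), hρ, summable_weighted_coeff_mul f g
    (fun α => ∏ i, min (ε i) (δ i) ^ α i) h0 (fun α β => ?_) ?_ ?_⟩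
  · rw [← Finset.prod_mul_distrib]
    exact Finset.prod_congr rfl fun i _ => by rw [Finsupp.add_apply, pow_add]
  · refine Summable.of_nonneg_of_le (fun α => mul_nonneg (norm_nonneg _) (h0 α)) (fun α => ?_) hf
    exact mul_le_mul_of_nonneg_left (Finset.prod_le_prod (fun i _ => pow_nonneg (hρ i).le _)
        fun i _ => pow_le_pow_left₀ (hρ i).le (min_le_left _ _) _) (norm_nonneg _)
  · refine Summable.of_nonneg_of_le (fun α => mul_nonneg (norm_nonneg _) (h0 α)) (fun α => ?_) hg
    exact mul_le_mul_of_nonneg_left (Finset.prod_le_prod (fun i _ => pow_nonneg (hρ i).le _)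
        fun i _ => pow_le_pow_left₀ (hρ i).le (min_le_right _ _) _) (norm_nonneg _)

theorem isConvergent_C {K : Type*} [NormedField K] {n : ℕ} (c : K) :
    IsConvergent (MvPowerSeries.C c : MvPowerSeries (Fin n) K) := by
  classical
  refine ⟨fun _ => 1, fun _ => one_pos, ?_⟩
  refine summable_of_ne_finset_zero (s := {0}) fun α hα => ?_
  rw [MvPowerSeries.coeff_C, if_neg (by simpa using hα)]
  simp

theorem IsConvergent.pderiv {K : Type*} [NormedField K] {n : ℕ} {f : MvPowerSeries (Fin n) K}
    (hf : IsConvergent f) (i : Fin n) : IsConvergent (MvPowerSeries.pderiv K i f) := by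
  classical
  obtain ⟨ε, hε, hf⟩ := hf
  refine ⟨fun j => ε j / 2, fun j => half_pos (hε j), ?_⟩
  have hinj : Function.Injective fun α : Fin n →₀ ℕ => α + Finsupp.single i 1 :=
    add_left_injective _
  have hs := (hf.comp_injective hinj).mul_left (ε i)⁻¹
  have hh : ∀ j, 0 ≤ ε j / 2 := fun j => (half_pos (hε j)).le
  refine Summable.of_nonneg_of_le
    (fun α => mul_nonneg (norm_nonneg _) (Finset.prod_nonneg fun j _ => pow_nonneg (hh j) _))
    (fun α => ?_) hs
  simp only [Function.comp_apply]
  rw [MvPowerSeries.coeff_pderiv, norm_mul]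
  have h1 : ‖((α i : K) + 1)‖ ≤ (α i : ℝ) + 1 := by
    have := Nat.norm_cast_le (α := K) (α i + 1)
    simpa using this
  have h2 : ∏ j, ε j ^ (α + Finsupp.single i 1 : Fin n →₀ ℕ) j = (∏ j, ε j ^ α j) * ε i := by
    have : ∀ j, ε j ^ (α + Finsupp.single i 1 : Fin n →₀ ℕ) j = ε j ^ α j * (if j = i then ε i else 1) := by
      intro j
      by_cases h : j = i
      · subst h; simp [pow_succ]
      · simp [h]
    simp_rw [this]
    rw [Finset.prod_mul_distrib]
    simp
  have h3 : ((α i : ℝ) + 1) * ∏ j, (ε j / 2) ^ α j ≤ ∏ j, ε j ^ α j := by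
    have e : ∏ j, (ε j / 2) ^ α j = (∏ j, ε j ^ α j) * ∏ j, ((1 : ℝ) / 2) ^ α j := by
      rw [← Finset.prod_mul_distrib]
      exact Finset.prod_congr rfl fun j _ => by rw [← mul_pow]; ring
    have hb : ∏ j, ((1 : ℝ) / 2) ^ α j ≤ (1 / 2) ^ α i := by
      rw [← Finset.mul_prod_erase _ _ (Finset.mem_univ i)]
      refine mul_le_of_le_one_right (by positivity) ?_
      exact Finset.prod_le_one (fun j _ => by positivity)
        fun j _ => pow_le_one₀ (by norm_num) (by norm_num)
    have hc : ((α i : ℝ) + 1) * (1 / 2) ^ α i ≤ 1 := by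
      have h2p : ((α i : ℝ) + 1) ≤ 2 ^ α i := by
        exact_mod_cast (Nat.lt_two_pow_self (n := α i))
      rw [one_div, inv_pow, ← div_eq_mul_inv]
      exact (div_le_one (by positivity)).mpr h2p
    have hP : 0 ≤ ∏ j, ε j ^ α j := Finset.prod_nonneg fun j _ => pow_nonneg (hε j).le _
    rw [e]
    calc _ = (∏ j, ε j ^ α j) * (((α i : ℝ) + 1) * ∏ j, ((1 : ℝ) / 2) ^ α j) := by ring
      _ ≤ (∏ j, ε j ^ α j) * 1 := by
        refine mul_le_mul_of_nonneg_left (le_trans ?_ hc) hP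
        exact mul_le_mul_of_nonneg_left hb (by positivity)
      _ = _ := mul_one _
  rw [h2]
  have hεi : ε i ≠ 0 := (hε i).ne'
  have hP2 : 0 ≤ ∏ j, (ε j / 2) ^ α j := Finset.prod_nonneg fun j _ => pow_nonneg (hh j) _
  set c := ‖MvPowerSeries.coeff (α + Finsupp.single i 1) f‖
  have hc0 : 0 ≤ c := norm_nonneg _
  calc c * ‖((α i : K) + 1)‖ * ∏ j, (ε j / 2) ^ α j
      ≤ c * (((α i : ℝ) + 1) * ∏ j, (ε j / 2) ^ α j) := by
        rw [mul_assoc]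
        exact mul_le_mul_of_nonneg_left (mul_le_mul_of_nonneg_right h1 hP2) hc0
    _ ≤ c * ∏ j, ε j ^ α j := mul_le_mul_of_nonneg_left h3 hc0
    _ = _ := by field_simp

/-- The ring `K{x_1, …, x_n}` of convergent power series, as a subalgebra of the ring
`K[[x_1, …, x_n]]` of formal power series. -/
def convergentSubalgebra (K : Type*) [NormedField K] (n : ℕ) :
    Subalgebra K (MvPowerSeries (Fin n) K) where
  carrier := {f | IsConvergent f}
  mul_mem' := IsConvergent.mul
  add_mem' := IsConvergent.add
  algebraMap_mem' := isConvergent_C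

/-- The `K`-algebra `K{x_1, …, x_n}`. -/
abbrev ConvSeries (K : Type*) [NormedField K] (n : ℕ) : Type _ := convergentSubalgebra K n

/-- The maximal ideal `𝔪 = ⟨x_1, …, x_n⟩` of `K{x}`: the series without constant term. -/
def maxIdeal (K : Type*) [NormedField K] (n : ℕ) : Ideal (ConvSeries K n) :=
  RingHom.ker ((MvPowerSeries.constantCoeff (σ := Fin n) (R := K)).comp
    (convergentSubalgebra K n).val.toRingHom)

/-! ### Milnor number and Tjurina number -/

/-- The partial derivative `∂f/∂x_i` in `K{x}`. -/
def partialDeriv {K : Type*} [NormedField K] {n : ℕ} (i : Fin n) (f : ConvSeries K n) :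
    ConvSeries K n :=
  ⟨MvPowerSeries.pderiv K i f.1, IsConvergent.pderiv f.2 i⟩

/-- `j(f) = ⟨∂f/∂x_1, …, ∂f/∂x_n⟩`. -/
def jacobianIdeal {K : Type*} [NormedField K] {n : ℕ} (f : ConvSeries K n) :
    Ideal (ConvSeries K n) :=
  Ideal.span (Set.range fun i => partialDeriv i f)

/-- `tj(f) = ⟨f, ∂f/∂x_1, …, ∂f/∂x_n⟩`. -/
def tjurinaIdeal {K : Type*} [NormedField K] {n : ℕ} (f : ConvSeries K n) :
    Ideal (ConvSeries K n) :=
  Ideal.span {f} ⊔ jacobianIdeal f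

/-- `μ(f) = dim_K K{x}/j(f)`, a natural number or `∞`. -/
def milnorNumber {K : Type*} [NormedField K] {n : ℕ} (f : ConvSeries K n) : ℕ∞ :=
  Cardinal.toENat (Module.rank K (ConvSeries K n ⧸ jacobianIdeal f))

/-- `τ(f) = dim_K K{x}/tj(f)`, a natural number or `∞`. -/
def tjurinaNumber {K : Type*} [NormedField K] {n : ℕ} (f : ConvSeries K n) : ℕ∞ :=
  Cardinal.toENat (Module.rank K (ConvSeries K n ⧸ tjurinaIdeal f))

/-! ### Right and contact equivalence -/

/-- `f` is right equivalent to `g`: `f = φ(g)` for some `φ ∈ Aut(K{x})`. The right equivalence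
classes are the orbits of the right group `Aut(K{x})`. -/
def RightEquivalent {K : Type*} [NormedField K] {n : ℕ} (f g : ConvSeries K n) : Prop :=
  ∃ φ : ConvSeries K n ≃ₐ[K] ConvSeries K n, f = φ g

/-- `f` is contact equivalent to `g`: `f = u · φ(g)` for some `φ ∈ Aut(K{x})` and some unit `u`.
The contact equivalence classes are the orbits of the contact group `K{x}ˣ ⋊ Aut(K{x})`. -/
def ContactEquivalent {K : Type*} [NormedField K] {n : ℕ} (f g : ConvSeries K n) : Prop :=
  ∃ (φ : ConvSeries K n ≃ₐ[K] ConvSeries K n) (u : (ConvSeries K n)ˣ), f = u * φ g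

/-! ### Zariski topology, jets -/

/-- A subset of the affine space `K^σ` is Zariski-open if its complement is the set of common
zeros of a set (equivalently, an ideal) of polynomials. -/
def IsZariskiOpen {K : Type*} [Field K] {σ : Type*} (U : Set (σ → K)) : Prop :=
  ∃ I : Ideal (MvPolynomial σ K), Uᶜ = MvPolynomial.zeroLocus K I

/-- The exponents `α` with `1 ≤ |α| ≤ k`; they index the monomials of the `k`-jets of series
without constant term. -/
abbrev JetIndex (n k : ℕ) : Type := {α : Fin n →₀ ℕ // 1 ≤ α.degree ∧ α.degree ≤ k}

/-- The `k`-jet of an element of `𝔪`, as a point of the affine space `𝔪/𝔪^(k+1)`, whose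
coordinates are the coefficients of the monomials of degrees `1, …, k`. -/
def jet {K : Type*} [NormedField K] {n : ℕ} (k : ℕ) (f : ConvSeries K n) : JetIndex n k → K :=
  fun α => MvPowerSeries.coeff α.1 f.1

/-- `V ⊆ 𝔪` is open: its image in the space of `k`-jets `𝔪/𝔪^(k+1)` is Zariski-open
for all `k`. -/
def IsJetOpen {K : Type*} [NormedField K] {n : ℕ} (V : Set (ConvSeries K n)) : Prop :=
  V ⊆ maxIdeal K n ∧ ∀ k : ℕ, IsZariskiOpen (jet k '' V)

/-! ### Simple singularities and finite deformation type -/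

/-- Simplicity of `f ∈ 𝔪` with respect to an equivalence relation `r` on `K{x}`: some open
neighbourhood of `f` in `𝔪` meets only finitely many `r`-classes. -/
def IsSimple {K : Type*} [NormedField K] {n : ℕ} (r : ConvSeries K n → ConvSeries K n → Prop)
    (f : ConvSeries K n) : Prop :=
  ∃ V : Set (ConvSeries K n), IsJetOpen V ∧ f ∈ V ∧
    ∃ S : Set (ConvSeries K n), S.Finite ∧ ∀ h ∈ V, ∃ g ∈ S, r h g

/-- The member `F_t(x) = F(x,t) ∈ K[[x]]` at the parameter `t ∈ K^k` of a family
`F(x,t) = ∑ a_α(t) x^α` with `a_α ∈ K[t_1, …, t_k]`. -/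
def fiber {K : Type*} [Field K] {n k : ℕ} (F : MvPowerSeries (Fin n) (MvPolynomial (Fin k) K))
    (t : Fin k → K) : MvPowerSeries (Fin n) K :=
  MvPowerSeries.map (MvPolynomial.eval t) F

/-- An unfolding (with trivial section) of `f` over `K^k`: a power series
`F(x,t) = ∑ a_α(t) x^α` in `x` with coefficients in `K[t_1, …, t_k]` such that `F_t ∈ K{x}` and
`F_t ∈ 𝔪` for every `t ∈ K^k`, and `F_0 = f`. -/
structure Unfolding {K : Type*} [NormedField K] {n : ℕ} (f : ConvSeries K n) (k : ℕ) where
  /-- the family `F(x,t)` -/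
  series : MvPowerSeries (Fin n) (MvPolynomial (Fin k) K)
  convergent : ∀ t : Fin k → K, IsConvergent (fiber series t)
  mem_maxIdeal : ∀ t : Fin k → K,
    (⟨fiber series t, convergent t⟩ : ConvSeries K n) ∈ maxIdeal K n
  fiber_zero : fiber series 0 = f.1

/-- The member `F_t ∈ K{x}` of an unfolding. -/
def Unfolding.member {K : Type*} [NormedField K] {n : ℕ} {f : ConvSeries K n} {k : ℕ}
    (F : Unfolding f k) (t : Fin k → K) : ConvSeries K n :=
  ⟨fiber F.series t, F.convergent t⟩

/-- `f` is of finite deformation type with respect to an equivalence relation `r` on `K{x}`: there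
is a finite set `S ⊆ K{x}` such that for every unfolding `F` of `f` over some `K^k` there is a
Zariski-open neighbourhood `U` of `0` in `K^k` such that each `F_t`, `t ∈ U`, is equivalent to an
element of `S`. -/
def IsOfFiniteDeformationType {K : Type*} [NormedField K] {n : ℕ}
    (r : ConvSeries K n → ConvSeries K n → Prop) (f : ConvSeries K n) : Prop :=
  ∃ S : Set (ConvSeries K n), S.Finite ∧
    ∀ (k : ℕ) (F : Unfolding f k), ∃ U : Set (Fin k → K), IsZariskiOpen U ∧ 0 ∈ U ∧
      ∀ t ∈ U, ∃ g ∈ S, r (F.member t) g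

end Singularity

end

noncomputable section

namespace Singularity

variable {K : Type*} [NormedField K] {n : ℕ}

/-! ### Monomials, division by variables, powers of the maximal ideal -/

/-! Let `I` be `j` or `tj`, and suppose `I(f)` has infinite colength. The colength of `I` is
constant on right, respectively contact, classes (chain rule `partialDeriv_map`), so its finite
values on the finite set `S` lie below some `N`. The contradiction comes from a series `v`,
equivalent to an element of `S`, whose colength is finite but at least `N`.

Such a `v` is found near `f + s·(x_1^(m+1) + ⋯ + x_n^(m+1))` with `m ≥ N` and `m + 1 ≠ 0` in `K`.
For almost all `s` the colength of `j + 𝔪^k` at this series is at most a bound `d` independent of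
`k` (`exists_finrank_quotient_fermat_le`): modulo `𝔪^k` the derivatives make every monomial with
some exponent `≥ m` redundant. If `v` has the same `k`-jet and `k > d`, Nakayama
(`le_finrank_quotient_sup_pow`) gives a power of `𝔪` inside `j(v)`, so `I(v)` has finite colength.
On the other hand `v ≡ f` modulo `𝔪^(N+1)`, hence `I(v) ⊆ I(f) + 𝔪^N`, and the latter has colength
at least `N` because `I(f)` contains no power of `𝔪`.

Both finiteness hypotheses supply such a `v` for all but finitely many `s`, since a Zariski-open set
contains almost all of every line through one of its points (`IsZariskiOpen.finite_line_notMem`). As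
`K` is infinite, a suitable `s` exists. -/

theorem isConvergent_monomial (α : Fin n →₀ ℕ) :
    IsConvergent (MvPowerSeries.monomial α (1 : K)) := by
  classical
  refine ⟨fun _ => 1, fun _ => one_pos, ?_⟩
  refine summable_of_ne_finset_zero (s := {α}) fun β hβ => ?_
  rw [MvPowerSeries.coeff_monomial, if_neg (by simpa using hβ)]
  simp

/-- The monomial `x^α` in `K{x}`. -/
def mono (K : Type*) [NormedField K] {n : ℕ} (α : Fin n →₀ ℕ) : ConvSeries K n :=
  ⟨MvPowerSeries.monomial α 1, isConvergent_monomial α⟩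

theorem mono_add (α β : Fin n →₀ ℕ) : mono K (α + β) = mono K α * mono K β :=
  Subtype.ext <| by simp [mono, MvPowerSeries.monomial_mul_monomial]

theorem mono_zero : mono K (0 : Fin n →₀ ℕ) = 1 :=
  Subtype.ext <| by simp [mono, MvPowerSeries.monomial_zero_one]

/-- The variable `x_i` in `K{x}`. -/
abbrev var (K : Type*) [NormedField K] {n : ℕ} (i : Fin n) : ConvSeries K n :=
  mono K (Finsupp.single i 1)

/-- The coefficient of `x^α`, as a linear form on `K{x}`. -/
def cf (K : Type*) [NormedField K] {n : ℕ} (α : Fin n →₀ ℕ) : ConvSeries K n →ₗ[K] K :=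
  (MvPowerSeries.coeff α).comp (convergentSubalgebra K n).val.toLinearMap

theorem cf_apply (α : Fin n →₀ ℕ) (f : ConvSeries K n) :
    cf K α f = MvPowerSeries.coeff α f.1 := rfl

theorem ext_cf {f g : ConvSeries K n} (h : ∀ α, cf K α f = cf K α g) : f = g :=
  Subtype.ext <| MvPowerSeries.ext h

open Classical in
theorem cf_mono (α β : Fin n →₀ ℕ) : cf K α (mono K β) = if α = β then 1 else 0 := by
  rw [cf_apply, mono, MvPowerSeries.coeff_monomial]

theorem cf_mul (α : Fin n →₀ ℕ) (f g : ConvSeries K n) :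
    cf K α (f * g) = ∑ p ∈ Finset.HasAntidiagonal.antidiagonal α, cf K p.1 f * cf K p.2 g :=
  MvPowerSeries.coeff_mul _ _ _

open Classical in
theorem cf_var_mul (α : Fin n →₀ ℕ) (i : Fin n) (f : ConvSeries K n) :
    cf K α (var K i * f) = if Finsupp.single i 1 ≤ α then cf K (α - Finsupp.single i 1) f
      else 0 := by
  rw [cf_apply]
  refine (MvPowerSeries.coeff_monomial_mul _ _ _ _).trans ?_
  simp [cf_apply]

theorem mem_maxIdeal_iff {f : ConvSeries K n} : f ∈ maxIdeal K n ↔ cf K 0 f = 0 := Iff.rfl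

theorem IsConvergent.shift {f : MvPowerSeries (Fin n) K} (hf : IsConvergent f)
    (β : Fin n →₀ ℕ) (p : (Fin n →₀ ℕ) → Prop) [DecidablePred p] :
    IsConvergent (fun γ => if p γ then MvPowerSeries.coeff (γ + β) f else 0) := by
  obtain ⟨ε, hε, hf⟩ := hf
  refine ⟨ε, hε, ?_⟩
  have hs := (hf.comp_injective (add_left_injective β)).mul_left (∏ i, ε i ^ β i)⁻¹
  have hp : ∀ γ : Fin n →₀ ℕ, 0 < ∏ i, ε i ^ γ i := fun γ =>
    Finset.prod_pos fun i _ => pow_pos (hε i) _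
  refine Summable.of_nonneg_of_le (fun α => mul_nonneg (norm_nonneg _) (hp α).le) (fun α => ?_) hs
  have h1 : ‖MvPowerSeries.coeff α
      (fun γ => if p γ then MvPowerSeries.coeff (γ + β) f else 0 : MvPowerSeries (Fin n) K)‖ ≤
      ‖MvPowerSeries.coeff (α + β) f‖ := by
    change ‖if p α then MvPowerSeries.coeff (α + β) f else 0‖ ≤ _
    split_ifs <;> simp
  refine (mul_le_mul_of_nonneg_right h1 (hp α).le).trans (le_of_eq ?_)
  have h2 : ∏ i, ε i ^ (α + β) i = (∏ i, ε i ^ α i) * ∏ i, ε i ^ β i := by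
    rw [← Finset.prod_mul_distrib]
    exact Finset.prod_congr rfl fun i _ => by rw [Finsupp.add_apply, pow_add]
  simp only [Function.comp_apply, h2]
  have := (hp β).ne'
  field_simp

/-- The quotient by `x_i` of the part of `f` whose monomials involve `x_i` but no earlier
variable. -/
def divVar (i : Fin n) (f : ConvSeries K n) : ConvSeries K n := by
  classical
  exact ⟨_, f.2.shift (Finsupp.single i 1) fun γ => ∀ j < i, γ j = 0⟩

open Classical in
theorem cf_divVar (i : Fin n) (f : ConvSeries K n) (γ : Fin n →₀ ℕ) :
    cf K γ (divVar i f) = if ∀ j < i, γ j = 0 then cf K (γ + Finsupp.single i 1) f else 0 := by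
  rw [cf_apply, divVar, MvPowerSeries.coeff_apply]
  rfl

/-- Each nonconstant monomial is assigned to the smallest variable occurring in it, so exactly one
summand produces it. This division drives every induction on powers of `𝔪`. -/
theorem eq_add_sum_divVar (f : ConvSeries K n) :
    f = algebraMap K _ (cf K 0 f) + ∑ i, var K i * divVar i f := by
  classical
  refine ext_cf fun α => ?_
  rw [map_add, map_sum]
  have hC : cf K α (algebraMap K (ConvSeries K n) (cf K 0 f)) = if α = 0 then cf K 0 f else 0 := by
    rw [cf_apply]
    exact MvPowerSeries.coeff_C _ _
  rw [hC]
  simp_rw [cf_var_mul, cf_divVar]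
  by_cases hα : α = 0
  · subst hα
    simp
  · rw [if_neg hα, zero_add]
    have hne : α.support.Nonempty := Finsupp.support_nonempty_iff.mpr hα
    set i₀ := α.support.min' hne with hi₀
    have hmem : i₀ ∈ α.support := Finset.min'_mem _ _
    have hlt : ∀ j < i₀, α j = 0 := fun j hj => by
      by_contra h
      exact absurd (Finset.min'_le _ j (Finsupp.mem_support_iff.mpr h)) (not_le.mpr hj)
    have hle : Finsupp.single i₀ 1 ≤ α := by
      rw [Finsupp.single_le_iff]
      exact Nat.one_le_iff_ne_zero.mpr (Finsupp.mem_support_iff.mp hmem)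
    rw [Finset.sum_eq_single i₀]
    · rw [if_pos hle, if_pos, tsub_add_cancel_of_le hle]
      intro j hj
      simp [hlt j hj]
    · intro i _ hi
      split_ifs with h1 h2
      · exfalso
        rw [Finsupp.single_le_iff] at h1
        rcases lt_or_gt_of_ne hi with h | h
        · have := hlt i h
          omega
        · have := h2 i₀ h
          rw [Finsupp.tsub_apply, Finsupp.single_eq_of_ne h.ne] at this
          exact Finsupp.mem_support_iff.mp hmem (by simpa using this)
      · rfl
      · rfl
    · simp

theorem var_mem (i : Fin n) : var K i ∈ maxIdeal K n := by
  classical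
  rw [mem_maxIdeal_iff, cf_mono, if_neg]
  intro h
  have := DFunLike.congr_fun h i
  simp at this

theorem cf_eq_zero_of_mem_pow {k : ℕ} {f : ConvSeries K n} (hf : f ∈ maxIdeal K n ^ k) :
    ∀ α : Fin n →₀ ℕ, α.degree < k → cf K α f = 0 := by
  induction k generalizing f with
  | zero => intro α h; omega
  | succ k ih =>
    intro α hα
    rw [pow_succ] at hf
    induction hf using Submodule.mul_induction_on' with
    | mem_mul_mem a ha b hb =>
      rw [cf_mul]
      refine Finset.sum_eq_zero fun p hp => ?_
      have hp' : p.1 + p.2 = α := Finset.HasAntidiagonal.mem_antidiagonal.mp hp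
      by_cases h : p.2 = 0
      · rw [h, mem_maxIdeal_iff.mp hb, mul_zero]
      · rw [ih ha p.1, zero_mul]
        have h1 : p.1.degree + p.2.degree = α.degree := by rw [← hp', map_add]
        have h2 : p.2.degree ≠ 0 := fun h0 => h ((Finsupp.degree_eq_zero_iff _).mp h0)
        omega
    | add a _ b _ ha hb => rw [map_add, ha, hb, add_zero]

theorem mem_maxIdeal_pow_iff {k : ℕ} {f : ConvSeries K n} :
    f ∈ maxIdeal K n ^ k ↔ ∀ α : Fin n →₀ ℕ, α.degree < k → cf K α f = 0 := by
  classical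
  refine ⟨cf_eq_zero_of_mem_pow, ?_⟩
  induction k generalizing f with
  | zero => simp
  | succ k ih =>
    intro h
    rw [eq_add_sum_divVar f, h 0 (by simp), map_zero, zero_add, pow_succ']
    refine Ideal.sum_mem _ fun i _ => Ideal.mul_mem_mul (var_mem i) (ih fun α hα => ?_)
    rw [cf_divVar]
    split_ifs
    · refine h _ ?_
      rw [map_add, Finsupp.degree_single]
      omega
    · rfl

theorem maxIdeal_eq_span : maxIdeal K n = Ideal.span (Set.range (var K)) := by
  refine le_antisymm (fun f hf => ?_) (Ideal.span_le.mpr ?_)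
  · rw [eq_add_sum_divVar f, mem_maxIdeal_iff.mp hf, map_zero, zero_add]
    exact Ideal.sum_mem _ fun i _ => Ideal.mul_mem_right _ _ (Ideal.subset_span ⟨i, rfl⟩)
  · rintro _ ⟨i, rfl⟩
    exact var_mem i

theorem maxIdeal_pow_fg (k : ℕ) : (maxIdeal K n ^ k).FG := by
  refine Ideal.FG.pow ?_
  rw [maxIdeal_eq_span]
  exact Submodule.fg_span (Set.finite_range _)

theorem eq_zero_of_forall_mem_pow {f : ConvSeries K n} (h : ∀ k, f ∈ maxIdeal K n ^ k) :
    f = 0 :=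
  ext_cf fun α => by
    rw [cf_eq_zero_of_mem_pow (h (α.degree + 1)) α (Nat.lt_succ_self _), map_zero]

/-! ### Units -/

/-- A geometric series argument: on a small enough polydisc `g` has weighted norm at most 1/2, so a
partial sum `A` of the norm of `h` satisfies `A ≤ 1 + A/2`, that is `A ≤ 2`. -/
theorem isConvergent_of_eq_one_add_mul {g h : MvPowerSeries (Fin n) K} (hg : IsConvergent g)
    (hg0 : MvPowerSeries.coeff 0 g = 0) (e : h = 1 + g * h) : IsConvergent h := by
  classical
  obtain ⟨ε, hε, hs⟩ := hg
  set B := ∑' α : Fin n →₀ ℕ, ‖MvPowerSeries.coeff α g‖ * ∏ i, ε i ^ α i with hB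
  have hterm : ∀ α : Fin n →₀ ℕ, 0 ≤ ‖MvPowerSeries.coeff α g‖ * ∏ i, ε i ^ α i := fun α =>
    mul_nonneg (norm_nonneg _) (Finset.prod_nonneg fun i _ => pow_nonneg (hε i).le _)
  have hB0 : 0 ≤ B := tsum_nonneg hterm
  -- Scaling all radii by `c ≤ 1` multiplies the term of `g` at `α` by `c^|α|`, which is at most `c`
  -- since `g` has no constant term.
  obtain ⟨c, hc0, hc1, hcB⟩ : ∃ c : ℝ, 0 < c ∧ c ≤ 1 ∧ c * B ≤ 1 / 2 := by
    refine ⟨1 / (2 * (B + 1)), by positivity, ?_, ?_⟩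
    · rw [div_le_one (by positivity)]; linarith
    · rw [one_div, inv_mul_le_iff₀ (by positivity)]; linarith
  set w : (Fin n →₀ ℕ) → ℝ := fun α => ∏ i, (c * ε i) ^ α i with hw
  have hcε : ∀ i, 0 < c * ε i := fun i => mul_pos hc0 (hε i)
  have hw0 : ∀ α, 0 ≤ w α := fun α => Finset.prod_nonneg fun i _ => pow_nonneg (hcε i).le _
  have hwadd : ∀ α β, w (α + β) = w α * w β := fun α β => by
    rw [hw, ← Finset.prod_mul_distrib]
    exact Finset.prod_congr rfl fun i _ => by rw [Finsupp.add_apply, pow_add]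
  have hwdeg : ∀ α, w α = c ^ α.degree * ∏ i, ε i ^ α i := fun α => by
    simp only [hw, mul_pow, Finset.prod_mul_distrib, Finset.prod_pow_eq_pow_sum,
      Finsupp.degree_eq_sum]
  have hgw : ∀ α, ‖MvPowerSeries.coeff α g‖ * w α ≤
      c * (‖MvPowerSeries.coeff α g‖ * ∏ i, ε i ^ α i) := fun α => by
    by_cases hα : α = 0
    · subst hα; simp [hg0]
    · have h1 : α.degree ≠ 0 := fun h0 => hα ((Finsupp.degree_eq_zero_iff _).mp h0)
      have h2 : c ^ α.degree ≤ c := pow_le_of_le_one hc0.le hc1 h1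
      rw [hwdeg]
      calc _ = c ^ α.degree * (‖MvPowerSeries.coeff α g‖ * ∏ i, ε i ^ α i) := by ring
        _ ≤ _ := mul_le_mul_of_nonneg_right h2 (hterm α)
  have hgsum : ∀ s : Finset (Fin n →₀ ℕ), ∑ α ∈ s, ‖MvPowerSeries.coeff α g‖ * w α ≤ 1 / 2 :=
    fun s => calc
      _ ≤ ∑ α ∈ s, c * (‖MvPowerSeries.coeff α g‖ * ∏ i, ε i ^ α i) :=
        Finset.sum_le_sum fun α _ => hgw α
      _ = c * ∑ α ∈ s, ‖MvPowerSeries.coeff α g‖ * ∏ i, ε i ^ α i := (Finset.mul_sum _ _ _).symm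
      _ ≤ c * B := mul_le_mul_of_nonneg_left (hs.sum_le_tsum s fun α _ => hterm α) hc0.le
      _ ≤ 1 / 2 := hcB
  -- Partial sums run over the boxes `Iic α`: these contain both parts of any splitting of their
  -- elements, so the Cauchy product is bounded by the same partial sum of `h`.
  have hA : ∀ α : Fin n →₀ ℕ, ∑ β ∈ Finset.Iic α, ‖MvPowerSeries.coeff β h‖ * w β ≤ 2 := by
    intro α
    set A := ∑ β ∈ Finset.Iic α, ‖MvPowerSeries.coeff β h‖ * w β with hAdef
    have hA0 : 0 ≤ A := Finset.sum_nonneg fun β _ => mul_nonneg (norm_nonneg _) (hw0 β)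
    have hone : ∑ β ∈ Finset.Iic α, ‖MvPowerSeries.coeff β (1 : MvPowerSeries (Fin n) K)‖ * w β
        ≤ 1 := by
      rw [Finset.sum_eq_single 0]
      · simp [hw]
      · intro β _ hβ
        rw [MvPowerSeries.coeff_one, if_neg hβ]; simp
      · intro h0; simp at h0
    have hmul : ∑ β ∈ Finset.Iic α, ‖MvPowerSeries.coeff β (g * h)‖ * w β ≤ 1 / 2 * A := by
      calc _ ≤ ∑ β ∈ Finset.Iic α, ∑ p ∈ Finset.HasAntidiagonal.antidiagonal β,
            (‖MvPowerSeries.coeff p.1 g‖ * w p.1) * (‖MvPowerSeries.coeff p.2 h‖ * w p.2) := by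
              refine Finset.sum_le_sum fun β _ => ?_
              rw [MvPowerSeries.coeff_mul]
              refine (mul_le_mul_of_nonneg_right (norm_sum_le _ _) (hw0 β)).trans ?_
              rw [Finset.sum_mul]
              refine Finset.sum_le_sum fun p hp => ?_
              rw [← Finset.HasAntidiagonal.mem_antidiagonal.mp hp, hwadd, norm_mul]
              exact le_of_eq (by ring)
        _ = ∑ p ∈ (Finset.Iic α).biUnion Finset.HasAntidiagonal.antidiagonal,
            (‖MvPowerSeries.coeff p.1 g‖ * w p.1) * (‖MvPowerSeries.coeff p.2 h‖ * w p.2) := by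
              rw [Finset.sum_biUnion]
              intro β _ γ _ hne
              rw [Function.onFun, Finset.disjoint_left]
              intro p hp hp'
              exact hne ((Finset.HasAntidiagonal.mem_antidiagonal.mp hp).symm.trans
                (Finset.HasAntidiagonal.mem_antidiagonal.mp hp'))
        _ ≤ ∑ p ∈ Finset.Iic α ×ˢ Finset.Iic α,
            (‖MvPowerSeries.coeff p.1 g‖ * w p.1) * (‖MvPowerSeries.coeff p.2 h‖ * w p.2) := by
              refine Finset.sum_le_sum_of_subset_of_nonneg ?_ fun p _ _ =>
                mul_nonneg (mul_nonneg (norm_nonneg _) (hw0 _)) (mul_nonneg (norm_nonneg _) (hw0 _))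
              intro p hp
              obtain ⟨β, hβ, hp⟩ := Finset.mem_biUnion.mp hp
              have h1 := Finset.HasAntidiagonal.mem_antidiagonal.mp hp
              have h2 := Finset.mem_Iic.mp hβ
              rw [Finset.mem_product, Finset.mem_Iic, Finset.mem_Iic]
              exact ⟨(le_self_add.trans h1.le).trans h2, (le_add_self.trans h1.le).trans h2⟩
        _ = (∑ β ∈ Finset.Iic α, ‖MvPowerSeries.coeff β g‖ * w β) * A := by
              rw [hAdef, Finset.sum_mul_sum, Finset.sum_product]
        _ ≤ 1 / 2 * A := mul_le_mul_of_nonneg_right (hgsum _) hA0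
    have : A ≤ 1 + 1 / 2 * A := by
      calc A ≤ ∑ β ∈ Finset.Iic α,
            (‖MvPowerSeries.coeff β (1 : MvPowerSeries (Fin n) K)‖ * w β
              + ‖MvPowerSeries.coeff β (g * h)‖ * w β) := by
              refine Finset.sum_le_sum fun β _ => ?_
              rw [← add_mul]
              refine mul_le_mul_of_nonneg_right ?_ (hw0 β)
              conv_lhs => rw [e, map_add]
              exact norm_add_le _ _
        _ ≤ _ := by rw [Finset.sum_add_distrib]; exact add_le_add hone hmul
    linarith
  refine ⟨fun i => c * ε i, hcε, summable_of_sum_le (c := 2)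
    (fun α => mul_nonneg (norm_nonneg _) (hw0 α)) fun s => ?_⟩
  refine (Finset.sum_le_sum_of_subset_of_nonneg (t := Finset.Iic (s.sup id)) ?_
    fun α _ _ => mul_nonneg (norm_nonneg _) (hw0 α)).trans (hA _)
  intro α hα
  exact Finset.mem_Iic.mpr (Finset.le_sup (f := id) hα)

/-- Writing `f = c(1 - g)` with `g ∈ 𝔪`, the formal inverse scaled by `c` solves `h = 1 + g h` and
therefore converges. -/
theorem isUnit_of_notMem {f : ConvSeries K n} (hf : f ∉ maxIdeal K n) : IsUnit f := by
  have hc : cf K 0 f ≠ 0 := hf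
  set c := cf K 0 f with hcdef
  set g : ConvSeries K n := 1 - c⁻¹ • f with hg
  have hc' : MvPowerSeries.constantCoeff f.1 ≠ 0 := hc
  have hinv : f.1 * f.1⁻¹ = 1 := MvPowerSeries.mul_inv_cancel _ hc'
  have hg1 : g.1 = 1 - c⁻¹ • f.1 := rfl
  have hg0 : MvPowerSeries.coeff 0 g.1 = 0 := by
    have : cf K 0 g = 0 := by
      rw [hg, map_sub, map_smul, ← hcdef, smul_eq_mul, inv_mul_cancel₀ hc, ← mono_zero, cf_mono]
      simp
    exact this
  have hconv : IsConvergent (c • f.1⁻¹) := by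
    refine isConvergent_of_eq_one_add_mul g.2 hg0 ?_
    rw [hg1, sub_mul, one_mul, smul_mul_smul_comm, inv_mul_cancel₀ hc, hinv, one_smul]
    ring
  refine IsUnit.of_mul_eq_one (c⁻¹ • (⟨_, hconv⟩ : ConvSeries K n)) (Subtype.ext ?_)
  change f.1 * (c⁻¹ • (c • f.1⁻¹)) = 1
  rw [smul_smul, inv_mul_cancel₀ hc, one_smul, hinv]

theorem notMem_of_isUnit {f : ConvSeries K n} (hf : IsUnit f) : f ∉ maxIdeal K n := fun h =>
  (hf.map ((MvPowerSeries.constantCoeff (σ := Fin n) (R := K)).comp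
    (convergentSubalgebra K n).val.toRingHom)).ne_zero h

theorem maxIdeal_le_jacobson : maxIdeal K n ≤ Ideal.jacobson ⊥ := fun f hf => by
  rw [Ideal.mem_jacobson_bot]
  intro g
  refine isUnit_of_notMem fun h => notMem_of_isUnit (isUnit_one (M := ConvSeries K n)) ?_
  exact (Ideal.add_mem_iff_right _ (Ideal.mul_mem_right g _ hf)).mp h

/-- The ideal `𝔪` consists exactly of the nonunits, so an abstract algebra automorphism is
automatically local. -/
theorem map_mem_maxIdeal (φ : ConvSeries K n ≃ₐ[K] ConvSeries K n) {f : ConvSeries K n}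
    (hf : f ∈ maxIdeal K n) : φ f ∈ maxIdeal K n := by
  by_contra h
  exact notMem_of_isUnit ((MulEquiv.isUnit_map φ).mp (isUnit_of_notMem h)) hf

/-! ### The chain rule for automorphisms -/

theorem cf_partialDeriv (α : Fin n →₀ ℕ) (i : Fin n) (f : ConvSeries K n) :
    cf K α (partialDeriv i f) = cf K (α + Finsupp.single i 1) f * (α i + 1) :=
  MvPowerSeries.coeff_pderiv _ _

theorem partialDeriv_add (i : Fin n) (f g : ConvSeries K n) :
    partialDeriv i (f + g) = partialDeriv i f + partialDeriv i g :=
  Subtype.ext <| map_add (MvPowerSeries.pderiv K i) f.1 g.1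

theorem partialDeriv_smul (i : Fin n) (c : K) (f : ConvSeries K n) :
    partialDeriv i (c • f) = c • partialDeriv i f :=
  Subtype.ext <| (MvPowerSeries.pderiv K i).map_smul c f.1

theorem partialDeriv_mul (i : Fin n) (f g : ConvSeries K n) :
    partialDeriv i (f * g) = f * partialDeriv i g + g * partialDeriv i f :=
  Subtype.ext <| (MvPowerSeries.pderiv K i).leibniz f.1 g.1

/-- The partial derivative as a `K`-linear map. -/
def partialDerivₗ (i : Fin n) : ConvSeries K n →ₗ[K] ConvSeries K n where
  toFun := partialDeriv i
  map_add' := partialDeriv_add i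
  map_smul' := partialDeriv_smul i

theorem partialDeriv_var (i j : Fin n) :
    partialDeriv i (var K j) = if i = j then 1 else 0 := by
  classical
  refine ext_cf fun α => ?_
  rw [cf_partialDeriv, cf_mono, ← mono_zero]
  by_cases h : i = j
  · subst h
    by_cases hα : α = 0
    · subst hα; simp [cf_mono]
    · simp [cf_mono, hα]
  · rw [if_neg h, if_neg, map_zero, zero_mul]
    intro e
    have := DFunLike.congr_fun e i
    simp [Finsupp.single_eq_of_ne h] at this

/-- From `g = c + ∑ x_i g_i` one gets `D g = ∑ φ(x_i) D g_i`, with `φ(x_i) ∈ 𝔪`. Iterating puts `D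
g` in every power of `𝔪`; no continuity of `φ` or `D` is needed. -/
theorem eq_zero_of_leibniz_of_var (φ : ConvSeries K n ≃ₐ[K] ConvSeries K n)
    (D : ConvSeries K n →ₗ[K] ConvSeries K n)
    (hD : ∀ a b, D (a * b) = φ a * D b + φ b * D a) (hvar : ∀ i, D (var K i) = 0) : D = 0 := by
  have h1 : D 1 = 0 := by
    have := hD 1 1
    rw [mul_one, map_one φ, one_mul] at this
    exact left_eq_add.mp this
  have key : ∀ k g, D g ∈ maxIdeal K n ^ k := by
    intro k
    induction k with
    | zero => simp
    | succ k ih =>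
      intro g
      rw [eq_add_sum_divVar g, map_add, Algebra.algebraMap_eq_smul_one, map_smul, h1, smul_zero,
        zero_add, map_sum, pow_succ']
      refine Ideal.sum_mem _ fun i _ => ?_
      rw [hD, hvar, mul_zero, add_zero]
      exact Ideal.mul_mem_mul (map_mem_maxIdeal φ (var_mem i)) (ih _)
  exact LinearMap.ext fun g => eq_zero_of_forall_mem_pow fun k => key k g

/-- Both sides are derivations along `φ` in the argument `g`, and they agree on the variables. -/
theorem partialDeriv_map (φ : ConvSeries K n ≃ₐ[K] ConvSeries K n) (i : Fin n)
    (g : ConvSeries K n) :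
    partialDeriv i (φ g) = ∑ j, φ (partialDeriv j g) * partialDeriv i (φ (var K j)) := by
  have := eq_zero_of_leibniz_of_var φ
    ((partialDerivₗ i).comp φ.toLinearMap - ∑ j, (LinearMap.mulRight K
      (partialDeriv i (φ (var K j)))).comp (φ.toLinearMap.comp (partialDerivₗ j))) ?_ ?_
  · have h := LinearMap.congr_fun this g
    simpa [partialDerivₗ, sub_eq_zero] using h
  · intro a b
    simp only [partialDerivₗ, LinearMap.sub_apply, LinearMap.comp_apply, LinearMap.coe_mk,
      AddHom.coe_mk, AlgEquiv.toLinearMap_apply, LinearMap.sum_apply, LinearMap.mulRight_apply,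
      map_mul, map_add, partialDeriv_mul, Finset.sum_add_distrib, mul_sub,
      Finset.mul_sum, mul_assoc]
    ring
  · intro j
    simp [partialDerivₗ, partialDeriv_var, apply_ite φ]

theorem jacobianIdeal_le_iff {f : ConvSeries K n} {I : Ideal (ConvSeries K n)} :
    jacobianIdeal f ≤ I ↔ ∀ i, partialDeriv i f ∈ I := by
  rw [jacobianIdeal, Ideal.span_le]
  exact Set.range_subset_iff

theorem partialDeriv_mem_jacobianIdeal (i : Fin n) (f : ConvSeries K n) :
    partialDeriv i f ∈ jacobianIdeal f := jacobianIdeal_le_iff.mp le_rfl i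

theorem tjurinaIdeal_le_iff {f : ConvSeries K n} {I : Ideal (ConvSeries K n)} :
    tjurinaIdeal f ≤ I ↔ f ∈ I ∧ ∀ i, partialDeriv i f ∈ I := by
  rw [tjurinaIdeal, sup_le_iff, Ideal.span_singleton_le_iff_mem, jacobianIdeal_le_iff]

theorem self_mem_tjurinaIdeal (f : ConvSeries K n) : f ∈ tjurinaIdeal f :=
  (tjurinaIdeal_le_iff.mp le_rfl).1

theorem partialDeriv_mem_tjurinaIdeal (i : Fin n) (f : ConvSeries K n) :
    partialDeriv i f ∈ tjurinaIdeal f := (tjurinaIdeal_le_iff.mp le_rfl).2 i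

theorem jacobianIdeal_map_le (φ : ConvSeries K n ≃ₐ[K] ConvSeries K n) (g : ConvSeries K n) :
    jacobianIdeal (φ g) ≤ (jacobianIdeal g).map φ := by
  rw [jacobianIdeal_le_iff]
  intro i
  rw [partialDeriv_map]
  exact Ideal.sum_mem _ fun j _ => Ideal.mul_mem_right _ _
    (Ideal.mem_map_of_mem φ (partialDeriv_mem_jacobianIdeal j g))

theorem tjurinaIdeal_map_le (φ : ConvSeries K n ≃ₐ[K] ConvSeries K n) (u g : ConvSeries K n) :
    tjurinaIdeal (u * φ g) ≤ (tjurinaIdeal g).map φ := by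
  have hg : φ g ∈ (tjurinaIdeal g).map φ := Ideal.mem_map_of_mem φ (self_mem_tjurinaIdeal g)
  refine tjurinaIdeal_le_iff.mpr ⟨Ideal.mul_mem_left _ _ hg, fun i => ?_⟩
  rw [partialDeriv_mul, partialDeriv_map]
  refine Ideal.add_mem _ (Ideal.mul_mem_left _ _ ?_) (Ideal.mul_mem_right _ _ hg)
  exact Ideal.sum_mem _ fun j _ => Ideal.mul_mem_right _ _
    (Ideal.mem_map_of_mem φ (partialDeriv_mem_tjurinaIdeal j g))

theorem map_jacobianIdeal (φ : ConvSeries K n ≃ₐ[K] ConvSeries K n) (g : ConvSeries K n) :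
    (jacobianIdeal g).map φ = jacobianIdeal (φ g) := by
  refine le_antisymm ?_ (jacobianIdeal_map_le φ g)
  have h := jacobianIdeal_map_le φ.symm (φ g)
  rw [φ.symm_apply_apply] at h
  exact (Ideal.map_mono h).trans_eq (Ideal.map_of_equiv φ.symm.toRingEquiv)

theorem map_tjurinaIdeal (φ : ConvSeries K n ≃ₐ[K] ConvSeries K n) (u : (ConvSeries K n)ˣ)
    (g : ConvSeries K n) : (tjurinaIdeal g).map φ = tjurinaIdeal ((u : ConvSeries K n) * φ g) := by
  refine le_antisymm ?_ (tjurinaIdeal_map_le φ u g)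
  -- The inverse contact transformation is `φ⁻¹` together with the unit `φ⁻¹(u⁻¹)`.
  have h := tjurinaIdeal_map_le φ.symm (φ.symm (↑u⁻¹ : ConvSeries K n)) (u * φ g)
  rw [← map_mul, Units.inv_mul_cancel_left, φ.symm_apply_apply] at h
  exact (Ideal.map_mono h).trans_eq (Ideal.map_of_equiv φ.symm.toRingEquiv)

theorem RightEquivalent.quotient_equiv {f g : ConvSeries K n} (h : RightEquivalent f g) :
    Nonempty ((ConvSeries K n ⧸ jacobianIdeal f) ≃ₗ[K] (ConvSeries K n ⧸ jacobianIdeal g)) := by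
  obtain ⟨φ, rfl⟩ := h
  exact ⟨(Ideal.quotientEquivAlg _ _ φ (map_jacobianIdeal φ g).symm).symm.toLinearEquiv⟩

theorem ContactEquivalent.quotient_equiv {f g : ConvSeries K n} (h : ContactEquivalent f g) :
    Nonempty ((ConvSeries K n ⧸ tjurinaIdeal f) ≃ₗ[K] (ConvSeries K n ⧸ tjurinaIdeal g)) := by
  obtain ⟨φ, u, rfl⟩ := h
  exact ⟨(Ideal.quotientEquivAlg _ _ φ (map_tjurinaIdeal φ u g).symm).symm.toLinearEquiv⟩

/-! ### Dependence on jets -/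

theorem partialDeriv_mem_pow (i : Fin n) {k : ℕ} {f : ConvSeries K n}
    (hf : f ∈ maxIdeal K n ^ (k + 1)) : partialDeriv i f ∈ maxIdeal K n ^ k := by
  rw [mem_maxIdeal_pow_iff] at hf ⊢
  intro α hα
  rw [cf_partialDeriv, hf, zero_mul]
  rw [map_add, Finsupp.degree_single]
  omega

theorem partialDeriv_mem_sup_of_sub_mem (i : Fin n) {k : ℕ} {f g : ConvSeries K n}
    (h : f - g ∈ maxIdeal K n ^ (k + 1)) {I : Ideal (ConvSeries K n)}
    (hI : partialDeriv i g ∈ I) : partialDeriv i f ∈ I ⊔ maxIdeal K n ^ k := by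
  have e : partialDeriv i f = partialDeriv i g + partialDeriv i (f - g) := by
    rw [← partialDeriv_add, add_sub_cancel]
  rw [e]
  exact Submodule.add_mem_sup hI (partialDeriv_mem_pow i h)

theorem jacobianIdeal_le_sup {k : ℕ} {f g : ConvSeries K n}
    (h : f - g ∈ maxIdeal K n ^ (k + 1)) :
    jacobianIdeal f ≤ jacobianIdeal g ⊔ maxIdeal K n ^ k :=
  jacobianIdeal_le_iff.mpr fun i =>
    partialDeriv_mem_sup_of_sub_mem i h (partialDeriv_mem_jacobianIdeal i g)

theorem tjurinaIdeal_le_sup {k : ℕ} {f g : ConvSeries K n}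
    (h : f - g ∈ maxIdeal K n ^ (k + 1)) :
    tjurinaIdeal f ≤ tjurinaIdeal g ⊔ maxIdeal K n ^ k := by
  refine tjurinaIdeal_le_iff.mpr ⟨?_, fun i =>
    partialDeriv_mem_sup_of_sub_mem i h (partialDeriv_mem_tjurinaIdeal i g)⟩
  rw [← add_sub_cancel g f]
  exact Submodule.add_mem_sup (self_mem_tjurinaIdeal g) (Ideal.pow_le_pow_right k.le_succ h)

/-! ### Colength and powers of the maximal ideal -/

/-- The coefficients of degree less than `k`, as a linear map. -/
def trunc (K : Type*) [NormedField K] (n k : ℕ) :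
    ConvSeries K n →ₗ[K] ({α : Fin n →₀ ℕ // α.degree < k} → K) :=
  LinearMap.pi fun α => cf K α.1

theorem trunc_eq_zero_iff {k : ℕ} {f : ConvSeries K n} :
    trunc K n k f = 0 ↔ f ∈ maxIdeal K n ^ k := by
  rw [mem_maxIdeal_pow_iff, funext_iff, Subtype.forall]
  rfl

theorem finite_degree_lt (n k : ℕ) : Finite {α : Fin n →₀ ℕ // α.degree < k} := by
  refine Set.Finite.subset (Finsupp.finite_of_degree_le k) fun α hα => ?_
  exact Nat.le_of_lt hα

theorem finite_quotient_of_pow_le {k : ℕ} {I : Ideal (ConvSeries K n)}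
    (h : maxIdeal K n ^ k ≤ I) : Module.Finite K (ConvSeries K n ⧸ I) := by
  have := finite_degree_lt n k
  have hfin : Module.Finite K (ConvSeries K n ⧸ LinearMap.ker (trunc K n k)) :=
    Module.Finite.equiv (trunc K n k).quotKerEquivRange.symm
  refine Module.Finite.of_surjective
    ((LinearMap.ker (trunc K n k)).liftQ (Ideal.Quotient.mkₐ K I).toLinearMap ?_) ?_
  · intro f hf
    exact Ideal.Quotient.eq_zero_iff_mem.mpr (h (trunc_eq_zero_iff.mp hf))
  · intro x
    obtain ⟨f, rfl⟩ := Ideal.Quotient.mk_surjective x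
    exact ⟨Submodule.Quotient.mk f, rfl⟩

theorem finrank_quotient_le {I J : Ideal (ConvSeries K n)} (h : I ≤ J)
    [Module.Finite K (ConvSeries K n ⧸ I)] :
    Module.finrank K (ConvSeries K n ⧸ J) ≤ Module.finrank K (ConvSeries K n ⧸ I) :=
  LinearMap.finrank_le_finrank_of_surjective (f := (Ideal.Quotient.factorₐ K h).toLinearMap)
    (Ideal.Quotient.factor_surjective h)

theorem finrank_quotient_lt {I J : Ideal (ConvSeries K n)} (h : I < J)
    [Module.Finite K (ConvSeries K n ⧸ I)] :
    Module.finrank K (ConvSeries K n ⧸ J) < Module.finrank K (ConvSeries K n ⧸ I) := by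
  have hs : Function.Surjective (Ideal.Quotient.factorₐ K h.le).toLinearMap :=
    Ideal.Quotient.factor_surjective h.le
  have : Module.Finite K (ConvSeries K n ⧸ J) := Module.Finite.of_surjective _ hs
  refine lt_of_le_of_ne (finrank_quotient_le h.le) fun e => h.not_ge fun f hf => ?_
  have hinj := (LinearMap.injective_iff_surjective_of_finrank_eq_finrank e.symm).mpr hs
  refine Ideal.Quotient.eq_zero_iff_mem.mp (hinj ?_)
  rw [map_zero]
  exact Ideal.Quotient.eq_zero_iff_mem.mpr hf

/-- If `I + 𝔪^(i+1) = I + 𝔪^i`, Nakayama for the finitely generated ideal `𝔪^i` gives `𝔪^i ⊆ I`.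
Otherwise the chain `I + 𝔪^i` drops strictly, and each drop adds at least one dimension. -/
theorem le_finrank_quotient_sup_pow (I : Ideal (ConvSeries K n)) (k : ℕ)
    (h : ∀ i < k, ¬ maxIdeal K n ^ i ≤ I) :
    k ≤ Module.finrank K (ConvSeries K n ⧸ I ⊔ maxIdeal K n ^ k) := by
  induction k with
  | zero => exact Nat.zero_le _
  | succ k ih =>
    have hlt : I ⊔ maxIdeal K n ^ (k + 1) < I ⊔ maxIdeal K n ^ k := by
      refine lt_of_le_of_ne (sup_le_sup_left (Ideal.pow_le_pow_right k.le_succ) _) fun e => ?_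
      refine h k k.lt_succ_self (Submodule.le_of_le_smul_of_le_jacobson_bot
        (maxIdeal_pow_fg k) maxIdeal_le_jacobson ?_)
      rw [smul_eq_mul, ← pow_succ', e]
      exact le_sup_right
    have : Module.Finite K (ConvSeries K n ⧸ I ⊔ maxIdeal K n ^ (k + 1)) :=
      finite_quotient_of_pow_le le_sup_right
    exact (ih fun i hi => h i (hi.trans k.lt_succ_self)).trans_lt (finrank_quotient_lt hlt)

/-! ### Perturbation by a Fermat polynomial -/

/-- The Fermat polynomial `x_1^(m+1) + ⋯ + x_n^(m+1)`. -/
def fermat (K : Type*) [NormedField K] (n m : ℕ) : ConvSeries K n :=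
  ∑ i, mono K (Finsupp.single i (m + 1))

theorem fermat_mem_pow (m : ℕ) : fermat K n m ∈ maxIdeal K n ^ (m + 1) := by
  classical
  refine Ideal.sum_mem _ fun i _ => mem_maxIdeal_pow_iff.mpr fun α hα => ?_
  rw [cf_mono, if_neg]
  rintro rfl
  rw [Finsupp.degree_single] at hα
  exact lt_irrefl _ hα

theorem partialDeriv_fermat (i : Fin n) (m : ℕ) :
    partialDeriv i (fermat K n m) = ((m : K) + 1) • mono K (Finsupp.single i m) := by
  classical
  refine ext_cf fun α => ?_
  rw [cf_partialDeriv, fermat, map_sum, map_smul, smul_eq_mul, cf_mono]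
  simp_rw [cf_mono]
  rw [Finset.sum_eq_single i]
  · have h : α + Finsupp.single i 1 = Finsupp.single i (m + 1) ↔ α = Finsupp.single i m := by
      rw [Finsupp.single_add, add_left_inj]
    by_cases hα : α = Finsupp.single i m
    · rw [if_pos (h.mpr hα), if_pos hα, hα, Finsupp.single_eq_same]
      ring
    · rw [if_neg (h.not.mpr hα), if_neg hα, zero_mul, mul_zero]
  · intro j _ hj
    rw [if_neg]
    intro e
    have := DFunLike.congr_fun e i
    simp [Finsupp.single_eq_of_ne hj.symm] at this
  · simp

/-- If `x_i^m` divides `x^α`, a multiple of the `i`-th derivative of the perturbed series is `x^α`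
times `s` plus a term coming from `f` alone. That `y` is chosen before `s` is what allows the
eigenvalue argument below. -/
theorem exists_smul_mono_add_mem (f : ConvSeries K n) {m : ℕ} (hm : (m : K) + 1 ≠ 0)
    (α : Fin n →₀ ℕ) (hα : ∃ i, m ≤ α i) :
    ∃ y, ∀ s : K, y + s • mono K α ∈ jacobianIdeal (f + s • fermat K n m) := by
  obtain ⟨i, hi⟩ := hα
  set β := α - Finsupp.single i m with hβ
  have hαβ : mono K α = mono K β * mono K (Finsupp.single i m) := by
    rw [← mono_add, hβ, tsub_add_cancel_of_le (Finsupp.single_le_iff.mpr hi)]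
  refine ⟨((m : K) + 1)⁻¹ • (mono K β * partialDeriv i f), fun s => ?_⟩
  have h : ((m : K) + 1)⁻¹ • (mono K β * partialDeriv i (f + s • fermat K n m)) ∈
      jacobianIdeal (f + s • fermat K n m) :=
    Submodule.smul_of_tower_mem _ _
      (Ideal.mul_mem_left _ _ (partialDeriv_mem_jacobianIdeal i _))
  convert h using 1
  rw [partialDeriv_add, partialDeriv_smul, partialDeriv_fermat, mul_add, smul_add, hαβ,
    mul_smul_comm, mul_smul_comm, smul_comm s, inv_smul_smul₀ hm]

theorem trunc_mono (k : ℕ) [DecidableEq {α : Fin n →₀ ℕ // α.degree < k}]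
    (α : {α : Fin n →₀ ℕ // α.degree < k}) :
    trunc K n k (mono K α.1) = Pi.single α 1 := by
  ext β
  rw [trunc, LinearMap.pi_apply, cf_mono, Pi.single_apply]
  simp only [Subtype.ext_iff]

/-- Modulo `𝔪^k` the elements `y α + s x^α` are the columns of `T + s·1`, where `T` is a fixed
square matrix. They span unless `-s` is an eigenvalue of `T`. -/
theorem exists_finite_mem_span_sup (k : ℕ) (y : (Fin n →₀ ℕ) → ConvSeries K n) :
    ∃ Z : Set K, Z.Finite ∧ ∀ s ∉ Z, ∀ g : ConvSeries K n,
      ∃ c : {α : Fin n →₀ ℕ // α.degree < k} → K, ∃ S : Finset {α : Fin n →₀ ℕ // α.degree < k},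
        g - ∑ α ∈ S, c α • (y α.1 + s • mono K α.1) ∈ maxIdeal K n ^ k := by
  classical
  have := finite_degree_lt n k
  have := Fintype.ofFinite {α : Fin n →₀ ℕ // α.degree < k}
  set T : Module.End K ({α : Fin n →₀ ℕ // α.degree < k} → K) :=
    (Pi.basisFun K {α : Fin n →₀ ℕ // α.degree < k}).constr K
      (fun α => trunc K n k (y α.1)) with hT
  refine ⟨Neg.neg ⁻¹' spectrum K T, (Module.End.finite_spectrum T).preimage
    neg_injective.injOn, fun s hs g => ?_⟩
  have hu : IsUnit (algebraMap K _ (-s) - T) := spectrum.notMem_iff.mp hs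
  obtain ⟨c, hc⟩ := ((Module.End.isUnit_iff _).mp hu).2 (trunc K n k g)
  refine ⟨-c, Finset.univ, ?_⟩
  rw [← trunc_eq_zero_iff, map_sub, map_sum, ← hc, sub_eq_zero]
  simp only [map_smul, map_add, trunc_mono, smul_add, Finset.sum_add_distrib]
  have h1 : T c = ∑ α, c α • trunc K n k (y α.1) := by
    rw [hT, Module.Basis.constr_apply_fintype]
    simp
  have h2 : ∑ α, (-c) α • s • (Pi.single α (1 : K) : {α : Fin n →₀ ℕ // α.degree < k} → K)
      = (-s) • c := by
    ext β
    simp [Finset.sum_apply, Pi.single_apply, mul_comm]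
  rw [h2, LinearMap.sub_apply, h1, Module.algebraMap_end_apply]
  simp only [Pi.neg_apply, neg_smul, Finset.sum_neg_distrib]
  abel

/-- For almost all `s`, the colength of `j(f + s·(x_1^(m+1) + ⋯ + x_n^(m+1))) + 𝔪^k` is bounded
independently of `k`. -/
theorem exists_finrank_quotient_fermat_le (f : ConvSeries K n) {m : ℕ} (hm : (m : K) + 1 ≠ 0) :
    ∃ d : ℕ, ∀ k : ℕ, ∃ Z : Set K, Z.Finite ∧ ∀ s ∉ Z, Module.finrank K
      (ConvSeries K n ⧸ jacobianIdeal (f + s • fermat K n m) ⊔ maxIdeal K n ^ k) ≤ d := by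
  classical
  have hfin : Finite {α : Fin n →₀ ℕ // ¬ ∃ i, m ≤ α i} := by
    refine Set.Finite.subset (Set.finite_Iic (Finsupp.equivFunOnFinite.symm fun _ : Fin n => m))
      fun α hα i => ?_
    have : ¬ m ≤ α i := fun h => hα ⟨i, h⟩
    simpa using (not_le.mp this).le
  have := Fintype.ofFinite {α : Fin n →₀ ℕ // ¬ ∃ i, m ≤ α i}
  refine ⟨Fintype.card {α : Fin n →₀ ℕ // ¬ ∃ i, m ≤ α i}, fun k => ?_⟩
  -- With `y = 0` at exponents all of whose entries are below `m`, the spanning elements there are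
  -- multiples of the monomials counted by the bound; all other spanning elements vanish in the
  -- quotient.
  have hy : ∀ α : Fin n →₀ ℕ, ∃ y : ConvSeries K n,
      ((∃ i, m ≤ α i) → ∀ s : K, y + s • mono K α ∈ jacobianIdeal (f + s • fermat K n m)) ∧
      ((¬ ∃ i, m ≤ α i) → y = 0) := fun α => by
    by_cases h : ∃ i, m ≤ α i
    · obtain ⟨y, hy⟩ := exists_smul_mono_add_mem f hm α h
      exact ⟨y, fun _ => hy, fun h' => absurd h h'⟩
    · exact ⟨0, fun h' => absurd h' h, fun _ => rfl⟩
  choose y hy1 hy2 using hy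
  obtain ⟨Z, hZ, hspan⟩ := exists_finite_mem_span_sup k y
  refine ⟨Z, hZ, fun s hs => ?_⟩
  set J := jacobianIdeal (f + s • fermat K n m) ⊔ maxIdeal K n ^ k with hJ
  set L := Fintype.linearCombination K
    (fun β : {α : Fin n →₀ ℕ // ¬ ∃ i, m ≤ α i} => Ideal.Quotient.mkₐ K J (mono K β.1)) with hL
  have hsurj : Function.Surjective L := by
    rw [← LinearMap.range_eq_top, eq_top_iff]
    intro x _
    obtain ⟨g, rfl⟩ := Ideal.Quotient.mk_surjective x
    obtain ⟨c, S, hc⟩ := hspan s hs g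
    have e : Ideal.Quotient.mkₐ K J g =
        Ideal.Quotient.mkₐ K J (∑ α ∈ S, c α • (y α.1 + s • mono K α.1)) := by
      rw [← sub_eq_zero, ← map_sub]
      exact Ideal.Quotient.eq_zero_iff_mem.mpr (Ideal.mem_sup_right hc)
    change Ideal.Quotient.mkₐ K J g ∈ _
    rw [e, map_sum]
    refine Submodule.sum_mem _ fun α _ => ?_
    rw [map_smul]
    refine Submodule.smul_mem _ _ ?_
    by_cases h : ∃ i, m ≤ α.1 i
    · have h0 : Ideal.Quotient.mkₐ K J (y α.1 + s • mono K α.1) = 0 :=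
        Ideal.Quotient.eq_zero_iff_mem.mpr (Ideal.mem_sup_left (hy1 α.1 h s))
      rw [h0]
      exact Submodule.zero_mem _
    · rw [hy2 α.1 h, zero_add, map_smul]
      refine Submodule.smul_mem _ _ ⟨Pi.single ⟨α.1, h⟩ 1, ?_⟩
      rw [hL, Fintype.linearCombination_apply_single, one_smul]
  exact (LinearMap.finrank_le_finrank_of_surjective hsurj).trans_eq
    (Module.finrank_fintype_fun_eq_card K)

/-! ### Zariski-open sets and lines -/

/-- Some polynomial of the defining ideal is nonzero at `a`; restricted to the line it is a nonzero
polynomial in `s`, and it vanishes wherever the line leaves `U`. -/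
theorem IsZariskiOpen.finite_line_notMem {F σ : Type*} [Field F] {U : Set (σ → F)}
    (hU : IsZariskiOpen U) {a : σ → F} (ha : a ∈ U) (b : σ → F) :
    {s : F | a + s • b ∉ U}.Finite := by
  obtain ⟨I, hI⟩ := hU
  have ha' : a ∉ MvPolynomial.zeroLocus F I := by
    rw [← hI]
    exact fun h => h ha
  obtain ⟨p, hp, hpa⟩ : ∃ p ∈ I, MvPolynomial.eval a p ≠ 0 := by
    by_contra! h
    exact ha' fun p hp => by simpa [MvPolynomial.aeval_eq_eval] using h p hp
  set q : Polynomial F := MvPolynomial.aeval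
    (fun i => Polynomial.C (a i) + Polynomial.X * Polynomial.C (b i)) p with hq
  have heval : ∀ s, q.eval s = MvPolynomial.eval (a + s • b) p := fun s => by
    rw [hq, ← Polynomial.coe_aeval_eq_eval, ← AlgHom.comp_apply, MvPolynomial.comp_aeval,
      ← MvPolynomial.aeval_eq_eval]
    congr 2
    ext i
    simp only [map_add, map_mul, Polynomial.aeval_C, Polynomial.aeval_X, Algebra.algebraMap_self,
      RingHom.id_apply, Pi.add_apply, Pi.smul_apply, smul_eq_mul]
  have hq0 : q ≠ 0 := by
    intro h
    apply hpa
    have := heval 0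
    rw [h, Polynomial.eval_zero, zero_smul, add_zero] at this
    exact this.symm
  refine (q.rootSet_finite F).subset fun s hs => ?_
  have h1 : a + s • b ∈ MvPolynomial.zeroLocus F I := by
    rw [← hI]
    exact hs
  rw [Polynomial.mem_rootSet]
  refine ⟨hq0, ?_⟩
  rw [Polynomial.coe_aeval_eq_eval, heval]
  simpa [MvPolynomial.aeval_eq_eval] using h1 p hp

/-! ### Finite codimension -/

theorem exists_le_cast_add_one_ne_zero (F : Type*) [Field F] (N : ℕ) :
    ∃ m : ℕ, N ≤ m ∧ (m : F) + 1 ≠ 0 := by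
  by_cases h : (N : F) + 1 = 0
  · refine ⟨N + 1, N.le_succ, ?_⟩
    rw [Nat.cast_succ, h, zero_add]
    exact one_ne_zero
  · exact ⟨N, le_rfl, h⟩

/-- Finite colength of `I(f)` for `I = j` or `I = tj`, if for every `h` and almost all `s` some
series with the `k`-jet of `f + s h` is equivalent to an element of a finite set. -/
theorem finite_quotient_of_perturbation [Infinite K]
    (I : ConvSeries K n → Ideal (ConvSeries K n)) (hjI : ∀ f, jacobianIdeal f ≤ I f)
    (hI : ∀ {k : ℕ} {f g : ConvSeries K n}, f - g ∈ maxIdeal K n ^ (k + 1) →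
      I f ≤ I g ⊔ maxIdeal K n ^ k)
    (r : ConvSeries K n → ConvSeries K n → Prop)
    (hr : ∀ {f g}, r f g → Nonempty ((ConvSeries K n ⧸ I f) ≃ₗ[K] (ConvSeries K n ⧸ I g)))
    (f : ConvSeries K n) (S : Set (ConvSeries K n)) (hS : S.Finite)
    (H : ∀ h ∈ maxIdeal K n, ∀ k : ℕ, {s : K | ¬ ∃ v, v - (f + s • h) ∈ maxIdeal K n ^ (k + 1) ∧
      ∃ g ∈ S, r v g}.Finite) :
    Module.Finite K (ConvSeries K n ⧸ I f) := by
  by_contra hf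
  -- Elements of `S` with infinite colength have `finrank` 0 here; this is harmless because the
  -- bound is applied only to a `g` equivalent to a series of finite colength.
  obtain ⟨N, hN⟩ : ∃ N : ℕ, ∀ g ∈ S, Module.finrank K (ConvSeries K n ⧸ I g) < N := by
    obtain ⟨B, hB⟩ := (hS.image fun g => Module.finrank K (ConvSeries K n ⧸ I g)).bddAbove
    exact ⟨B + 1, fun g hg => Nat.lt_succ_of_le (hB ⟨g, hg, rfl⟩)⟩
  obtain ⟨m, hNm, hm⟩ := exists_le_cast_add_one_ne_zero K N
  obtain ⟨d, hd⟩ := exists_finrank_quotient_fermat_le f hm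
  -- Jet order at least `d + 1` makes the colength bound `d` force a power of `𝔪` into `j(v)`; order
  -- at least `N` keeps `v` congruent to `f` modulo `𝔪^(N+1)`.
  obtain ⟨Z, hZ, hZd⟩ := hd (max (d + 1) N)
  have hfermat := fermat_mem_pow (K := K) (n := n) m
  obtain ⟨s, hs⟩ := (hZ.union (H (fermat K n m)
    (Ideal.pow_le_self m.succ_ne_zero hfermat) (max (d + 1) N))).exists_notMem
  rw [Set.mem_union, not_or, Set.mem_ofPred_eq, not_not] at hs
  obtain ⟨hsZ, v, hv, g, hgS, hvg⟩ := hs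
  have hjet : jacobianIdeal v ⊔ maxIdeal K n ^ max (d + 1) N =
      jacobianIdeal (f + s • fermat K n m) ⊔ maxIdeal K n ^ max (d + 1) N := by
    refine le_antisymm (sup_le (jacobianIdeal_le_sup hv) le_sup_right)
      (sup_le (jacobianIdeal_le_sup ?_) le_sup_right)
    rw [← neg_sub]
    exact neg_mem hv
  have hvd := hZd s hsZ
  rw [← hjet] at hvd
  obtain ⟨i, -, hi⟩ : ∃ i < max (d + 1) N, maxIdeal K n ^ i ≤ jacobianIdeal v := by
    by_contra! h
    have h1 := le_finrank_quotient_sup_pow (jacobianIdeal v) _ h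
    have h2 := le_max_left (d + 1) N
    omega
  -- Finiteness is essential for the comparison of `finrank`s below: for an infinite-dimensional
  -- quotient the value would be 0.
  have hvfin : Module.Finite K (ConvSeries K n ⧸ I v) :=
    finite_quotient_of_pow_le (hi.trans (hjI v))
  have hvf : v - f ∈ maxIdeal K n ^ (N + 1) := by
    rw [show v - f = v - (f + s • fermat K n m) + s • fermat K n m by abel]
    refine add_mem (Ideal.pow_le_pow_right (by omega) hv)
      (Submodule.smul_of_tower_mem _ _ (Ideal.pow_le_pow_right (by omega) hfermat))
  have h1 : N ≤ Module.finrank K (ConvSeries K n ⧸ I f ⊔ maxIdeal K n ^ N) :=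
    le_finrank_quotient_sup_pow _ _ fun i _ hi => hf (finite_quotient_of_pow_le hi)
  have h2 := finrank_quotient_le (hI hvf)
  obtain ⟨e⟩ := hr hvg
  have h3 := e.finrank_eq
  have h4 := hN g hgS
  omega

/-! ### Unfoldings along a line -/

/-- The unfolding `f + t h` of `f` over `K`. -/
def lineUnfolding (f h : ConvSeries K n) (hf : f ∈ maxIdeal K n) (hh : h ∈ maxIdeal K n) :
    Unfolding f 1 :=
  have key : ∀ t : Fin 1 → K, fiber (MvPowerSeries.map MvPolynomial.C f.1 +
      MvPowerSeries.C (MvPolynomial.X 0) * MvPowerSeries.map MvPolynomial.C h.1) t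
        = (f + t 0 • h).1 := fun t => by
    ext α
    simp [fiber, MvPowerSeries.coeff_C_mul]
  { series := MvPowerSeries.map MvPolynomial.C f.1 +
      MvPowerSeries.C (MvPolynomial.X 0) * MvPowerSeries.map MvPolynomial.C h.1
    convergent := fun t => by
      rw [key]
      exact (f + t 0 • h).2
    mem_maxIdeal := fun t => by
      have : f + t 0 • h ∈ maxIdeal K n := add_mem hf (Submodule.smul_of_tower_mem _ _ hh)
      convert this using 1
      exact Subtype.ext (key t)
    fiber_zero := by
      rw [key]
      simp }

theorem lineUnfolding_member (f h : ConvSeries K n) (hf : f ∈ maxIdeal K n)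
    (hh : h ∈ maxIdeal K n) (t : Fin 1 → K) :
    (lineUnfolding f h hf hh).member t = f + t 0 • h := by
  refine Subtype.ext (MvPowerSeries.ext fun α => ?_)
  simp [lineUnfolding, Unfolding.member, fiber, MvPowerSeries.coeff_C_mul]

/-- The unfolding `f + t h` over the affine line suffices, and `v` can be taken to be `f + s h`
itself. -/
theorem IsOfFiniteDeformationType.exists_perturbation
    {r : ConvSeries K n → ConvSeries K n → Prop} {f : ConvSeries K n} (hf : f ∈ maxIdeal K n)
    (H : IsOfFiniteDeformationType r f) :
    ∃ S : Set (ConvSeries K n), S.Finite ∧ ∀ h ∈ maxIdeal K n, ∀ k : ℕ,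
      {s : K | ¬ ∃ v, v - (f + s • h) ∈ maxIdeal K n ^ (k + 1) ∧ ∃ g ∈ S, r v g}.Finite := by
  obtain ⟨S, hS, H⟩ := H
  refine ⟨S, hS, fun h hh k => ?_⟩
  obtain ⟨U, hU, h0, HU⟩ := H 1 (lineUnfolding f h hf hh)
  refine (hU.finite_line_notMem h0 1).subset fun s hs hsU => hs ⟨f + s • h, ?_, ?_⟩
  · rw [sub_self]
    exact zero_mem _
  · have := HU _ hsU
    rw [lineUnfolding_member] at this
    simpa using this

theorem sub_mem_pow_of_jet_eq {k : ℕ} {f g : ConvSeries K n} (hf : f ∈ maxIdeal K n)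
    (hg : g ∈ maxIdeal K n) (h : jet k f = jet k g) : f - g ∈ maxIdeal K n ^ (k + 1) := by
  rw [mem_maxIdeal_pow_iff]
  intro α hα
  rw [map_sub, sub_eq_zero]
  by_cases h0 : α = 0
  · rw [h0, mem_maxIdeal_iff.mp hf, mem_maxIdeal_iff.mp hg]
  · have h1 : α.degree ≠ 0 := fun h1 => h0 ((Finsupp.degree_eq_zero_iff _).mp h1)
    exact congr_fun h ⟨α, by omega, by omega⟩

/-- Openness of `V` only constrains jets: `f + s h` need not lie in `V`, but for almost all `s` some
`v ∈ V` has its `k`-jet. This is why the common perturbation condition speaks of `v`. -/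
theorem IsSimple.exists_perturbation
    {r : ConvSeries K n → ConvSeries K n → Prop} {f : ConvSeries K n} (hf : f ∈ maxIdeal K n)
    (H : IsSimple r f) :
    ∃ S : Set (ConvSeries K n), S.Finite ∧ ∀ h ∈ maxIdeal K n, ∀ k : ℕ,
      {s : K | ¬ ∃ v, v - (f + s • h) ∈ maxIdeal K n ^ (k + 1) ∧ ∃ g ∈ S, r v g}.Finite := by
  obtain ⟨V, ⟨hVm, hV⟩, hfV, S, hS, H⟩ := H
  refine ⟨S, hS, fun h hh k => ?_⟩
  refine ((hV k).finite_line_notMem ⟨f, hfV, rfl⟩ (jet k h)).subset ?_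
  rintro s hs ⟨v, hvV, hv⟩
  refine hs ⟨v, sub_mem_pow_of_jet_eq (hVm hvV)
    (add_mem hf (Submodule.smul_of_tower_mem _ _ hh)) ?_, H v hvV⟩
  rw [hv]
  rfl

theorem milnorNumber_lt_top_of_perturbation [Infinite K] {f : ConvSeries K n}
    (H : ∃ S : Set (ConvSeries K n), S.Finite ∧ ∀ h ∈ maxIdeal K n, ∀ k : ℕ,
      {s : K | ¬ ∃ v, v - (f + s • h) ∈ maxIdeal K n ^ (k + 1) ∧
        ∃ g ∈ S, RightEquivalent v g}.Finite) : milnorNumber f < ⊤ := by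
  obtain ⟨S, hS, H⟩ := H
  have := finite_quotient_of_perturbation jacobianIdeal (fun _ => le_rfl) jacobianIdeal_le_sup
    RightEquivalent RightEquivalent.quotient_equiv f S hS H
  rw [milnorNumber, Cardinal.toENat_lt_top]
  exact Module.rank_lt_aleph0 K _

theorem tjurinaNumber_lt_top_of_perturbation [Infinite K] {f : ConvSeries K n}
    (H : ∃ S : Set (ConvSeries K n), S.Finite ∧ ∀ h ∈ maxIdeal K n, ∀ k : ℕ,
      {s : K | ¬ ∃ v, v - (f + s • h) ∈ maxIdeal K n ^ (k + 1) ∧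
        ∃ g ∈ S, ContactEquivalent v g}.Finite) : tjurinaNumber f < ⊤ := by
  obtain ⟨S, hS, H⟩ := H
  have := finite_quotient_of_perturbation tjurinaIdeal (fun _ => le_sup_right) tjurinaIdeal_le_sup
    ContactEquivalent ContactEquivalent.quotient_equiv f S hS H
  rw [tjurinaNumber, Cardinal.toENat_lt_top]
  exact Module.rank_lt_aleph0 K _

end Singularity

end

theorem lemma3p2 {K : Type*} [NormedField K] [IsAlgClosed K] (n : ℕ)
    (f : Singularity.ConvSeries K n) (hf : f ∈ Singularity.maxIdeal K n) :
    (Singularity.IsOfFiniteDeformationType Singularity.RightEquivalent f →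
        Singularity.milnorNumber f < ⊤) ∧
    (Singularity.IsOfFiniteDeformationType Singularity.ContactEquivalent f →
        Singularity.tjurinaNumber f < ⊤) ∧
    (Singularity.IsSimple Singularity.RightEquivalent f →
        Singularity.milnorNumber f < ⊤) ∧
    (Singularity.IsSimple Singularity.ContactEquivalent f →
        Singularity.tjurinaNumber f < ⊤) := by
  exact ⟨fun H => Singularity.milnorNumber_lt_top_of_perturbation (H.exists_perturbation hf),
    fun H => Singularity.tjurinaNumber_lt_top_of_perturbation (H.exists_perturbation hf),
    fun H => Singularity.milnorNumber_lt_top_of_perturbation (H.exists_perturbation hf),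
    fun H => Singularity.tjurinaNumber_lt_top_of_perturbation (H.exists_perturbation hf)⟩
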